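/- All graphs are finite and simple. The order of a graph is its number of vertices and its size is its number of edges. For a positive integer $p$, the book $B_p$ is the graph of order $p+2$ consisting of $p$ triangles sharing a common edge, and $\mathrm{ex}(n,H)$ denotes the maximum size of a graph of order $n$ that does not contain $H$ as a (not necessarily induced) subgraph. Write $\overline{G}$ for the complement of $G$, $G+H$ for the disjoint union of $G$ and $H$, $mH$ for the disjoint union of $m$ copies of $H$, and $G\cong H$ for isomorphism. Let $W$ be the graph with vertices $0,1,\dots,7$ and the ten edges $01,12,23,30,\;04,45,52,\;16,67,73$ (a 4-cycle in which each of the two pairs of opposite vertices is joined by an additional path of length 3, the two paths being disjoint). Let $Q$ be the graph with vertices $0,1,\dots,9$ and the twelve edges $01,02,03,\;14,15,45,\;26,27,67,\;38,39,89$ (a claw $K_{1,3}$ each of whose three leaves lies in an additional triangle, the three triangles being pairwise disjoint). Theorem. Let $p\ge 4$ be an integer and let $G$ be a graph of order $p+5$. (1) If $p\equiv 0\pmod 3$, then $G$ does not contain $B_p$ and has size $\mathrm{ex}(p+5,B_p)$ if and only if $G\cong\overline{\tfrac{p-3}{3}K_3+W}$. (2) If $p\equiv 1\pmod 3$, then $G$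 does not contain $B_p$ and has size $\mathrm{ex}(p+5,B_p)$ if and only if $G\cong\overline{\tfrac{p+5}{3}K_3}$. (3) If $p\equiv 2\pmod 3$, then $G$ does not contain $B_p$ and has size $\mathrm{ex}(p+5,B_p)$ if and only if $G\cong\overline{\tfrac{p+1}{3}K_3+K_4}$ or $G\cong\overline{\tfrac{p-5}{3}K_3+Q}$. -/

import Mathlib

namespace BookTuran

/-- The book `B_p` with `p` pages: the vertices `Sum.inl 0`, `Sum.inl 1` are the ends of the common
edge, and every vertex `Sum.inr i` forms a triangle with that edge.  Two distinct vertices are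
adjacent iff at least one of them is an end of the common edge. -/
def book (p : ℕ) : SimpleGraph (Fin 2 ⊕ Fin p) where
  Adj x y := x ≠ y ∧ (x.isLeft = true ∨ y.isLeft = true)
  symm := ⟨fun _ _ h => ⟨h.1.symm, h.2.symm⟩⟩
  loopless := ⟨fun _ h => h.1 rfl⟩

/-- The disjoint union `m H` of `m` copies of a graph `H`. -/
def copies {V : Type*} (m : ℕ) (H : SimpleGraph V) : SimpleGraph (Fin m × V) where
  Adj x y := x.1 = y.1 ∧ H.Adj x.2 y.2
  symm := ⟨fun _ _ h => ⟨h.1.symm, h.2.symm⟩⟩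
  loopless := ⟨fun _ h => h.2.ne rfl⟩

/-- The complete graph `K_n`. -/
abbrev K (n : ℕ) : SimpleGraph (Fin n) := SimpleGraph.completeGraph (Fin n)

/-- The graph `W` of order 8: a 4-cycle `0 1 2 3` in which the opposite vertices `0, 2` are joined
by the path `0 4 5 2`, and the opposite vertices `1, 3` by the path `1 6 7 3`. -/
def W : SimpleGraph (Fin 8) :=
  SimpleGraph.fromEdgeSet
    {s(0, 1), s(1, 2), s(2, 3), s(3, 0),
     s(0, 4), s(4, 5), s(5, 2),
     s(1, 6), s(6, 7), s(7, 3)}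

/-- The graph `Q` of order 10: a claw with center `0` and leaves `1, 2, 3`, together with three
disjoint triangles `1 4 5`, `2 6 7`, `3 8 9` at its leaves. -/
def Q : SimpleGraph (Fin 10) :=
  SimpleGraph.fromEdgeSet
    {s(0, 1), s(0, 2), s(0, 3),
     s(1, 4), s(1, 5), s(4, 5),
     s(2, 6), s(2, 7), s(6, 7),
     s(3, 8), s(3, 9), s(8, 9)}

end BookTuran

namespace BookTuran

open SimpleGraph

/-! Pass to the complement `H` of `G`, on `n = p + 5` vertices. An edge `uv` of `G` leaves `p + 3`
other vertices, so it has fewer than `p` common neighbours exactly when `u` and `v` together have at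
least four neighbours in `H`. Thus `G` is `B_p`-free iff `Good H`, and it is extremal iff `H` has
the least degree sum among good graphs (`free_book_iff`, `extremal_iff`).

For `n ≥ 9` a good graph with degree sum at most `2n + 4` has minimum degree at least 2
(`Good.two_le_degree`). Disjoint triangles attain `2n` when `3 ∣ n`, and nothing else does, since
two neighbours of a vertex in a 2-regular good graph are adjacent.

If `3 ∤ n`, let `S` be the set of vertices of degree other than 2. The total excess over degree 2 is
at most 4, and a vertex has at most two neighbours of degree 2, so its degree is at most `|S| + 1`.
This leaves few degree patterns. Outside the components meeting `S` everything is triangles, so `3 ∣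
n` as soon as those components have a multiple of 3 vertices in total; this disposes of `|S| ≤ 3`.
For four vertices of degree 3, the graph induced on `S` has no isolated vertex: `K_4`, the claw and
the 4-cycle force the components `K 4`, `Q` and `W`, while the diamond, paw, path and two disjoint
edges give a contradiction or `3 ∣ n` (`Quad.isExceptional`, `Sparse.isExceptional`). The surviving
graphs all have degree sum `2n + 4`, hence all are minimal, and the residue of `n` selects among
them. -/

/-! ### Translation to the complement -/

/-- Any two distinct non-adjacent vertices have at least four neighbours altogether. -/
def Good {V : Type*} (H : SimpleGraph V) : Prop :=
  ∀ u v, u ≠ v → ¬ H.Adj u v → 4 ≤ (H.neighborSet u ∪ H.neighborSet v).ncard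

theorem Good.iso {V V' : Type*} {H : SimpleGraph V} {H' : SimpleGraph V'} (hH : Good H)
    (e : H ≃g H') : Good H' := by
  have key : ∀ y x, H.Adj (e.symm y) x ↔ H'.Adj y (e x) := fun y x => by
    rw [← e.map_adj_iff, e.apply_symm_apply]
  intro u v huv hadj
  have h := hH (e.symm u) (e.symm v) (by simpa using huv) (by simpa [key] using hadj)
  rw [← Set.ncard_image_of_injective _ e.injective] at h
  convert h using 2
  ext w
  constructor
  · intro hw
    refine ⟨e.symm w, ?_, by simp⟩
    simpa [key] using hw
  · rintro ⟨x, hx, rfl⟩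
    simpa [key] using hx

theorem ncard_neighborSet {V : Type*} (H : SimpleGraph V) (v : V)
    [Fintype (H.neighborSet v)] : (H.neighborSet v).ncard = H.degree v := by
  rw [← Nat.card_coe_set_eq, Nat.card_eq_fintype_card, card_neighborSet_eq_degree]

theorem sum_degree_iso {V V' : Type*} [Fintype V] [Fintype V'] {H : SimpleGraph V}
    {H' : SimpleGraph V'} [H.LocallyFinite] [H'.LocallyFinite] (e : H ≃g H') :
    ∑ v, H.degree v = ∑ v, H'.degree v :=
  Fintype.sum_equiv e.toEquiv _ _ fun v => (e.degree_eq v).symm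

theorem free_book_iff {V : Type*} [Fintype V] (p : ℕ) (hV : Fintype.card V = p + 5)
    (G : SimpleGraph V) : (book p).Free G ↔ Good Gᶜ := by
  classical
  -- The `p + 3` vertices other than `u` and `v` split into the common `G`-neighbours and those
  -- joined to `u` or `v` in the complement.
  have key : ∀ u v, G.Adj u v → ((Gᶜ.neighborSet u ∪ Gᶜ.neighborSet v).ncard +
      (G.neighborSet u ∩ G.neighborSet v).ncard = p + 3) := by
    intro u v huv
    have hne := huv.ne
    have h1 : (Gᶜ.neighborSet u ∪ Gᶜ.neighborSet v) ∪ (G.neighborSet u ∩ G.neighborSet v) =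
        {u, v}ᶜ := by
      ext w
      by_cases hu : w = u
      · subst hu; simp [huv.symm]
      by_cases hv : w = v
      · subst hv; simp [huv]
      simp [hu, hv, Ne.symm hu, Ne.symm hv]
      tauto
    rw [← Set.ncard_union_eq, h1]
    · have := Set.ncard_add_ncard_compl ({u, v} : Set V)
      rw [Set.ncard_pair hne, Nat.card_eq_fintype_card, hV] at this
      omega
    · rw [Set.disjoint_left]
      intro w
      simp
      tauto
  constructor
  · intro hfree u v huv hadj
    have hG : G.Adj u v := by simpa [huv] using hadj
    by_contra hlt
    have hp : p ≤ (G.neighborSet u ∩ G.neighborSet v).ncard := by have := key u v hG; omega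
    apply hfree
    have : Fintype.card (Fin p) ≤
        Fintype.card (G.neighborSet u ∩ G.neighborSet v : Set V) := by
      rwa [Fintype.card_fin, ← Nat.card_eq_fintype_card, Nat.card_coe_set_eq]
    obtain ⟨f⟩ := Function.Embedding.nonempty_of_card_le this
    have hf : ∀ i, G.Adj u (f i) ∧ G.Adj v (f i) := fun i => (f i).2
    refine ⟨⟨⟨Sum.elim ![u, v] fun i => (f i : V), ?_⟩, ?_⟩⟩
    · rintro (i | i) (j | j) ⟨hij, h⟩
      · fin_cases i <;> fin_cases j <;> simp_all [G.adj_comm]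
      · fin_cases i <;> simp [hf]
      · fin_cases j <;> simp [(hf i).1.symm, (hf i).2.symm]
      · simp at h
    · rintro (i | i) (j | j) h
      · fin_cases i <;> fin_cases j <;> simp_all
      · exfalso
        fin_cases i
        · exact (hf j).1.ne (by simpa using h)
        · exact (hf j).2.ne (by simpa using h)
      · exfalso
        fin_cases j
        · exact (hf i).1.ne (by simpa using h.symm)
        · exact (hf i).2.ne (by simpa using h.symm)
      · simp only [RelHom.coeFn_mk, Sum.elim_inr] at h
        rw [f.injective (Subtype.ext h)]
  · rintro hgood ⟨f⟩
    have hadj : ∀ x y, (book p).Adj x y → G.Adj (f x) (f y) := fun x y h => f.toHom.map_adj h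
    have huv : G.Adj (f (.inl 0)) (f (.inl 1)) := hadj _ _ ⟨by simp, by simp⟩
    have h4 := hgood _ _ huv.ne (by simp [huv])
    have hk := key _ _ huv
    have hsub : Set.range (fun i : Fin p => f (.inr i)) ⊆
        G.neighborSet (f (.inl 0)) ∩ G.neighborSet (f (.inl 1)) := by
      rintro _ ⟨i, rfl⟩
      exact ⟨hadj _ _ ⟨by simp, by simp⟩, hadj _ _ ⟨by simp, by simp⟩⟩
    have hle := Set.ncard_le_ncard hsub (Set.toFinite _)
    have hinj : Function.Injective (fun i : Fin p => f (.inr i)) := fun i j h =>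
      Sum.inr_injective (f.injective h)
    rw [← Set.image_univ, Set.ncard_image_of_injective _ hinj, Set.ncard_univ,
      Nat.card_eq_fintype_card, Fintype.card_fin] at hle
    omega

/-- Twice the size of a graph plus the degree sum of its complement is constant, so maximal size
means minimal complementary degree sum. -/
theorem extremal_iff {V : Type*} [Fintype V] (p : ℕ) (hV : Fintype.card V = p + 5)
    (G : SimpleGraph V) [DecidableRel G.Adj] [DecidableEq V] :
    ((book p).Free G ∧ G.edgeFinset.card = extremalNumber (p + 5) (book p)) ↔
      Good Gᶜ ∧ ∀ (H : SimpleGraph V) [DecidableRel H.Adj], Good H →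
        ∑ v, Gᶜ.degree v ≤ ∑ v, H.degree v := by
  have hsum : ∀ (G : SimpleGraph V) [DecidableRel G.Adj],
      2 * G.edgeFinset.card + ∑ v, Gᶜ.degree v = Fintype.card V * (Fintype.card V - 1) := by
    intro G _
    rw [← G.sum_degrees_eq_twice_card_edges, ← Finset.sum_add_distrib]
    have : ∀ v, G.degree v + Gᶜ.degree v = Fintype.card V - 1 := by
      intro v
      have := G.degree_compl v
      have := G.degree_lt_card_verts v
      omega
    simp [this]
  rw [← hV, ← isExtremal_free_iff, IsExtremal, free_book_iff p hV]
  refine and_congr_right fun _ => ⟨fun h H _ hH => ?_, fun h G' _ hG' => ?_⟩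
  · have h1 := @h Hᶜ _ ((free_book_iff p hV _).2 (by simpa using hH))
    have h2 := hsum G
    have h3 := hsum Hᶜ
    have h4 : ∑ v, (Hᶜ)ᶜ.degree v = ∑ v, H.degree v := by
      refine Finset.sum_congr rfl fun v _ => ?_
      rw [← ncard_neighborSet, ← ncard_neighborSet, compl_compl]
    omega
  · have h1 := h G'ᶜ ((free_book_iff p hV _).1 hG')
    have h2 := hsum G
    have h3 := hsum G'
    omega

theorem iso_compl_iff {V V' : Type*} (G : SimpleGraph V) (X : SimpleGraph V') :
    Nonempty (G ≃g Xᶜ) ↔ Nonempty (Gᶜ ≃g X) := by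
  have aux : ∀ (G : SimpleGraph V) (X : SimpleGraph V'), Nonempty (G ≃g X) →
      Nonempty (Gᶜ ≃g Xᶜ) := fun G X ⟨e⟩ => 
    ⟨⟨e.toEquiv, fun {a b} => by
      have h : X.Adj (e a) (e b) ↔ G.Adj a b := e.map_adj_iff
      simp [h]⟩⟩
  exact ⟨fun h => by simpa using aux _ _ h, fun h => by simpa using aux _ _ h⟩

/-! ### Splitting off triangles -/

/-- "Equal or adjacent" is an equivalence relation here, with all classes of size three. -/
theorem exists_iso_copies_of_triangles {V : Type*} [Fintype V] {H : SimpleGraph V}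
    (hH : ∀ v, ∃ x y, x ≠ y ∧ H.Adj x y ∧ ∀ u, H.Adj v u ↔ u = x ∨ u = y) :
    3 ∣ Fintype.card V ∧ Nonempty (H ≃g copies (Fintype.card V / 3) (K 3)) := by
  classical
  have htrans : ∀ {u v w}, H.Adj u v → H.Adj v w → u = w ∨ H.Adj u w := by
    intro u v w huv hvw
    obtain ⟨x, y, hxy, h, hv⟩ := hH v
    have h1 := (hv u).1 huv.symm
    have h2 := (hv w).1 hvw
    have h3 := h.symm
    rcases h1 with rfl | rfl <;> rcases h2 with rfl | rfl <;> simp [h, h3]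
  let s : Setoid V :=
    { r := fun u v => u = v ∨ H.Adj u v
      iseqv :=
        { refl := fun _ => Or.inl rfl
          symm := fun h => h.elim (fun h => Or.inl h.symm) fun h => Or.inr h.symm
          trans := by
            rintro u v w (rfl | h1) (rfl | h2)
            · exact Or.inl rfl
            · exact Or.inr h2
            · exact Or.inr h1
            · exact htrans h1 h2 } }
  have hfib : ∀ q : Quotient s, Fintype.card {v // Quotient.mk s v = q} = 3 := by
    intro q
    induction q using Quotient.inductionOn with
    | h v =>
      obtain ⟨x, y, hxy, h, hv⟩ := hH v
      have hx : v ≠ x := ((hv x).2 (Or.inl rfl)).ne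
      have hy : v ≠ y := ((hv y).2 (Or.inr rfl)).ne
      rw [Fintype.card_subtype]
      have : (Finset.univ.filter fun u => Quotient.mk s u = Quotient.mk s v) = {v, x, y} := by
        ext u
        have h1 : Quotient.mk s u = Quotient.mk s v ↔ u = v ∨ H.Adj u v := Quotient.eq
        simp [h1, H.adj_comm u v, hv]
      rw [this, Finset.card_eq_three]
      exact ⟨v, x, y, hx, hy, hxy, rfl⟩
  let e : V ≃ Quotient s × Fin 3 :=
    (Equiv.sigmaFiberEquiv (Quotient.mk s)).symm.trans
      ((Equiv.sigmaCongrRight fun q => Fintype.equivFinOfCardEq (hfib q)).trans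
        (Equiv.sigmaEquivProd _ _))
  have he : ∀ v, (e v).1 = Quotient.mk s v := fun v => rfl
  have hcard : Fintype.card V = Fintype.card (Quotient s) * 3 := by
    rw [Fintype.card_congr e, Fintype.card_prod, Fintype.card_fin]
  have hq : Fintype.card (Quotient s) = Fintype.card V / 3 := by omega
  refine ⟨⟨_, hcard.trans (mul_comm _ _)⟩, ⟨⟨e.trans
    ((Fintype.equivFinOfCardEq hq).prodCongr (Equiv.refl _)), ?_⟩⟩⟩
  intro u v
  have h1 : Quotient.mk s u = Quotient.mk s v ↔ u = v ∨ H.Adj u v := Quotient.eq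
  have h2 : (e u).2 = (e v).2 ∧ (e u).1 = (e v).1 ↔ u = v := by
    rw [← e.injective.eq_iff, Prod.ext_iff, and_comm]
  simp only [copies, K, completeGraph, Equiv.trans_apply, Equiv.prodCongr_apply, Prod.map_fst,
    Prod.map_snd, Equiv.refl_apply, EmbeddingLike.apply_eq_iff_eq, top_adj]
  have h3 : H.Adj u v → u ≠ v := fun h => h.ne
  rw [he, he] at *
  tauto

/-- By `heX` the range of `e` is a union of components, so its complement is one too and consists of
triangles. -/
theorem exists_iso_copies_sum {V U : Type*} [Fintype V] [Fintype U] {H : SimpleGraph V}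
    {X : SimpleGraph U} (e : U → V) (he : Function.Injective e)
    (heX : ∀ i v, H.Adj (e i) v ↔ ∃ j, X.Adj i j ∧ v = e j)
    (hH : ∀ v ∉ Set.range e, ∃ x y, x ≠ y ∧ H.Adj x y ∧ ∀ u, H.Adj v u ↔ u = x ∨ u = y) :
    3 ∣ Fintype.card V - Fintype.card U ∧ Fintype.card U ≤ Fintype.card V ∧
      Nonempty (H ≃g copies ((Fintype.card V - Fintype.card U) / 3) (K 3) ⊕g X) := by
  classical
  have hcl : ∀ v ∉ Set.range e, ∀ u, H.Adj v u → u ∉ Set.range e := by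
    rintro v hv _ h ⟨i, rfl⟩
    obtain ⟨j, -, rfl⟩ := (heX i v).1 h.symm
    exact hv ⟨j, rfl⟩
  have hcard : Fintype.card ((Set.range e)ᶜ : Set V) = Fintype.card V - Fintype.card U := by
    rw [Fintype.card_compl_set, Set.card_range_of_injective he]
  have h := exists_iso_copies_of_triangles (H := H.induce (Set.range e)ᶜ) (by
    rintro ⟨v, hv⟩
    obtain ⟨x, y, hxy, hadj, hN⟩ := hH v hv
    refine ⟨⟨x, hcl v hv x ((hN x).2 (Or.inl rfl))⟩, ⟨y, hcl v hv y ((hN y).2 (Or.inr rfl))⟩,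
      by simpa using hxy, by simpa using hadj, ?_⟩
    rintro ⟨u, hu⟩
    simp [hN])
  rw [hcard] at h
  obtain ⟨h3, ⟨f⟩⟩ := h
  refine ⟨h3, Fintype.card_le_of_injective e he, ⟨?_⟩⟩
  have fX : H.induce (Set.range e) ≃g X := Iso.symm ⟨Equiv.ofInjective e he, by
    intro i j
    simp [heX, he.eq_iff]⟩
  refine RelIso.trans ?_ (Iso.sumCongr f fX)
  refine Iso.symm ⟨(Equiv.sumComm _ _).trans (Equiv.Set.sumCompl (Set.range e)), ?_⟩
  rintro (⟨u, hu⟩ | ⟨u, hu⟩) (⟨v, hv⟩ | ⟨v, hv⟩)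
  · simp
  · simpa using fun h => hcl u hu v h hv
  · simpa using fun h => hcl v hv u (H.adj_symm h) hu
  · simp

/-! ### The candidate graphs are good -/

/-- Vertices on different sides have disjoint neighbourhoods, each of size at least 2; this is why
minimum degree 2 is needed. -/
theorem Good.sum {V U : Type*} [Fintype V] [Fintype U] {H : SimpleGraph V} {X : SimpleGraph U}
    [DecidableRel H.Adj] [DecidableRel X.Adj] (hH : Good H) (hX : Good X)
    (hH2 : ∀ v, 2 ≤ H.degree v) (hX2 : ∀ v, 2 ≤ X.degree v) : Good (H ⊕g X) := by
  have hl : ∀ v, (H ⊕g X).neighborSet (.inl v) = Sum.inl '' H.neighborSet v := by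
    intro v; ext (w | w) <;> simp
  have hr : ∀ v, (H ⊕g X).neighborSet (.inr v) = Sum.inr '' X.neighborSet v := by
    intro v; ext (w | w) <;> simp
  have hlr : ∀ u v, 4 ≤ ((H ⊕g X).neighborSet (.inl u) ∪ (H ⊕g X).neighborSet (.inr v)).ncard := by
    intro u v
    rw [hl, hr, Set.ncard_union_eq (by
      rw [Set.disjoint_left]; rintro _ ⟨x, _, rfl⟩ ⟨y, _, h⟩; simp at h),
      Set.ncard_image_of_injective _ Sum.inl_injective,
      Set.ncard_image_of_injective _ Sum.inr_injective, ncard_neighborSet, ncard_neighborSet]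
    have := hH2 u
    have := hX2 v
    omega
  rintro (u | u) (v | v) huv hadj
  · rw [hl, hl, ← Set.image_union, Set.ncard_image_of_injective _ Sum.inl_injective]
    exact hH u v (by simpa using huv) (by simpa using hadj)
  · exact hlr u v
  · rw [Set.union_comm]
    exact hlr v u
  · rw [hr, hr, ← Set.image_union, Set.ncard_image_of_injective _ Sum.inr_injective]
    exact hX u v (by simpa using huv) (by simpa using hadj)

theorem neighborSet_copies {V : Type*} (m : ℕ) (H : SimpleGraph V) (i : Fin m) (v : V) :
    (copies m H).neighborSet (i, v) = Prod.mk i '' H.neighborSet v := by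
  ext ⟨j, w⟩
  simp only [mem_neighborSet, copies, Set.mem_image, Prod.mk.injEq]
  constructor
  · rintro ⟨rfl, h⟩; exact ⟨w, h, rfl, rfl⟩
  · rintro ⟨w, h, rfl, rfl⟩; exact ⟨rfl, h⟩

theorem degree_copies (m : ℕ) [DecidableRel (copies m (K 3)).Adj] (x : Fin m × Fin 3) :
    (copies m (K 3)).degree x = 2 := by
  obtain ⟨i, v⟩ := x
  rw [← ncard_neighborSet, neighborSet_copies,
    Set.ncard_image_of_injective _ (Prod.mk_right_injective i), ncard_neighborSet,
    ← card_neighborFinset_eq_degree]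
  revert v; decide

theorem good_copies (m : ℕ) : Good (copies m (K 3)) := by
  classical
  rintro ⟨i, u⟩ ⟨j, v⟩ huv hadj
  have hij : i ≠ j := by
    rintro rfl
    exact hadj ⟨rfl, by simpa using huv⟩
  rw [Set.ncard_union_eq, ncard_neighborSet, ncard_neighborSet, degree_copies, degree_copies]
  rw [Set.disjoint_left]
  rintro ⟨k, w⟩ ⟨h1, -⟩ ⟨h2, -⟩
  exact hij (h1.trans h2.symm)

theorem good_of_decide {k : ℕ} (X : SimpleGraph (Fin k)) [DecidableRel X.Adj]
    (h : ∀ u v, u ≠ v → ¬ X.Adj u v → 4 ≤ (X.neighborFinset u ∪ X.neighborFinset v).card) :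
    Good X := by
  intro u v huv hadj
  have := h u v huv hadj
  rwa [← Set.ncard_coe_finset, Finset.coe_union, coe_neighborFinset, coe_neighborFinset] at this

instance : DecidableRel W.Adj := fun a b => by
  unfold W; rw [fromEdgeSet_adj]; infer_instance

instance : DecidableRel Q.Adj := fun a b => by
  unfold Q; rw [fromEdgeSet_adj]; infer_instance

theorem good_K : Good (K 4) := fun u v huv hadj => absurd (by simpa using huv) hadj

theorem good_W : Good W := good_of_decide W (by decide)

theorem good_Q : Good Q := good_of_decide Q (by decide)

theorem sum_degree_sum_copies {U : Type*} [Fintype U] (m : ℕ) (X : SimpleGraph U)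
    [X.LocallyFinite] [(copies m (K 3) ⊕g X).LocallyFinite] :
    ∑ v, (copies m (K 3) ⊕g X).degree v = 6 * m + ∑ v, X.degree v := by
  classical
  rw [Fintype.sum_sum_type]
  have hl : ∀ v, (copies m (K 3) ⊕g X).degree (.inl v) = 2 := by
    intro v
    rw [← degree_copies m v, ← ncard_neighborSet, ← ncard_neighborSet,
      ← Set.ncard_image_of_injective ((copies m (K 3)).neighborSet v)
        (Sum.inl_injective (β := U))]
    congr 1
    ext (w | w) <;> simp
  have hr : ∀ v, (copies m (K 3) ⊕g X).degree (.inr v) = X.degree v := by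
    intro v
    rw [← ncard_neighborSet, ← ncard_neighborSet,
      ← Set.ncard_image_of_injective (X.neighborSet v) (Sum.inr_injective (α := Fin m × Fin 3))]
    congr 1
    ext (w | w) <;> simp
  simp [hl, hr]
  ring

/-! ### Local structure around vertices of degree two and three -/

/-- The local consequences of `Good` for vertices of degree two and three, together with a lower
bound on all degrees. -/
structure Sparse {V : Type*} [Fintype V] (H : SimpleGraph V) [DecidableRel H.Adj] : Prop where
  two_le : ∀ v, 2 ≤ H.degree v
  adj_of_two_two : ∀ w u v, H.degree u = 2 → H.degree v = 2 → H.Adj w u → H.Adj w v → u ≠ v →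
    H.Adj u v
  eq_of_two_three : ∀ u v w x, H.degree u = 2 → H.degree v = 3 → u ≠ v → ¬ H.Adj u v →
    H.Adj u w → H.Adj v w → H.Adj u x → H.Adj v x → w = x
  exists_of_three_three : ∀ u v, H.degree u = 3 → H.degree v = 3 → u ≠ v → ¬ H.Adj u v →
    ∃ w, H.Adj u w ∧ ¬ H.Adj v w

variable {V : Type*} [Fintype V] {H : SimpleGraph V} [DecidableRel H.Adj]

/-- Inclusion-exclusion. Each field of `Sparse` other than `two_le` is an instance for degrees 2 or
3. -/
theorem Good.inter_add_four_le (hH : Good H) {u v : V} (huv : u ≠ v) (hadj : ¬ H.Adj u v) :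
    (H.neighborSet u ∩ H.neighborSet v).ncard + 4 ≤ H.degree u + H.degree v := by
  have h := hH u v huv hadj
  have := Set.ncard_union_add_ncard_inter (H.neighborSet u) (H.neighborSet v)
  rw [ncard_neighborSet, ncard_neighborSet] at this
  omega

/-- An isolated vertex forces all others to degree at least 4, so the sum is at least `4n - 4`. A
vertex of degree 1 forces its `n - 2` non-neighbours to degree at least 3, so the sum is at least
`3n - 4`, which exceeds `2n + 4` exactly when `n ≥ 9`. -/
theorem Good.two_le_degree (hH : Good H) (hV : 9 ≤ Fintype.card V)
    (hsum : ∑ v, H.degree v ≤ 2 * Fintype.card V + 4) (v : V) : 2 ≤ H.degree v := by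
  classical
  by_contra hlt
  -- One inequality covers `v`, its neighbours and its non-neighbours; the two conditional terms
  -- correct for the first two kinds, so that it can be summed over all `u`.
  have hpt : ∀ u, 4 ≤ H.degree u + (if u = v then 4 - 2 * H.degree v else 0) +
      (if H.Adj v u then 3 - H.degree v else 0) + H.degree v := by
    intro u
    by_cases huv : u = v
    · subst huv; simp; omega
    by_cases hadj : H.Adj v u
    · have : 0 < H.degree u := (H.degree_pos_iff_exists_adj u).2 ⟨v, hadj.symm⟩
      simp [huv, hadj]; omega
    · have := hH.inter_add_four_le huv fun h => hadj h.symm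
      simp [huv, hadj]; omega
  have h := Finset.sum_le_sum fun u (_ : u ∈ Finset.univ) => hpt u
  have hd : (Finset.univ.filter fun u => H.Adj v u).card = H.degree v := by
    rw [← card_neighborFinset_eq_degree]; congr 1; ext; simp
  rw [Finset.sum_add_distrib, Finset.sum_add_distrib, Finset.sum_add_distrib,
    Finset.sum_ite_eq' Finset.univ v, ← Finset.sum_filter] at h
  simp only [Finset.sum_const, smul_eq_mul, Finset.card_univ, Finset.mem_univ, if_true, hd] at h
  have h01 : H.degree v = 0 ∨ H.degree v = 1 := by omega
  rcases h01 with h0 | h0 <;> rw [h0] at h <;> omega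

theorem Good.sparse (hH : Good H) (h2 : ∀ v, 2 ≤ H.degree v) : Sparse H where
  two_le := h2
  adj_of_two_two w u v hu hv hwu hwv huv := by
    by_contra hadj
    have h := hH.inter_add_four_le huv hadj
    have : 0 < (H.neighborSet u ∩ H.neighborSet v).ncard :=
      (Set.ncard_pos (Set.toFinite _)).2 ⟨w, hwu.symm, hwv.symm⟩
    omega
  eq_of_two_three u v w x hu hv huv hadj huw hvw hux hvx := by
    by_contra hwx
    have h := hH.inter_add_four_le huv hadj
    have : 1 < (H.neighborSet u ∩ H.neighborSet v).ncard :=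
      (Set.one_lt_ncard (Set.toFinite _)).2 ⟨w, ⟨huw, hvw⟩, x, ⟨hux, hvx⟩, hwx⟩
    omega
  exists_of_three_three u v hu hv huv hadj := by
    by_contra hcon
    push Not at hcon
    have h := hH.inter_add_four_le huv hadj
    have hsub : H.neighborSet u ∩ H.neighborSet v = H.neighborSet u :=
      Set.inter_eq_left.2 fun w hw => hcon w hw
    rw [hsub, ncard_neighborSet] at h
    omega

theorem exists_of_degree_two {v : V} (hv : H.degree v = 2) :
    ∃ x y, x ≠ y ∧ ∀ u, H.Adj v u ↔ u = x ∨ u = y := by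
  classical
  rw [← card_neighborFinset_eq_degree, Finset.card_eq_two] at hv
  obtain ⟨x, y, hxy, h⟩ := hv
  exact ⟨x, y, hxy, fun u => by rw [← mem_neighborFinset, h]; simp⟩

theorem exists_of_degree_three {v : V} (hv : H.degree v = 3) :
    ∃ x y z, x ≠ y ∧ x ≠ z ∧ y ≠ z ∧ ∀ u, H.Adj v u ↔ u = x ∨ u = y ∨ u = z := by
  classical
  rw [← card_neighborFinset_eq_degree, Finset.card_eq_three] at hv
  obtain ⟨x, y, z, hxy, hxz, hyz, h⟩ := hv
  exact ⟨x, y, z, hxy, hxz, hyz, fun u => by rw [← mem_neighborFinset, h]; simp⟩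

theorem exists_of_degree_two_of_adj {v x : V} (hv : H.degree v = 2) (hx : H.Adj v x) :
    ∃ y, y ≠ x ∧ ∀ u, H.Adj v u ↔ u = x ∨ u = y := by
  obtain ⟨a, b, hab, h⟩ := exists_of_degree_two hv
  rcases (h x).1 hx with rfl | rfl
  · exact ⟨b, by grind⟩
  · exact ⟨a, by grind⟩

theorem exists_of_degree_three_of_adj {v x : V} (hv : H.degree v = 3) (hx : H.Adj v x) :
    ∃ y z, y ≠ x ∧ z ≠ x ∧ y ≠ z ∧ ∀ u, H.Adj v u ↔ u = x ∨ u = y ∨ u = z := by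
  obtain ⟨a, b, c, hab, hac, hbc, h⟩ := exists_of_degree_three hv
  rcases (h x).1 hx with rfl | rfl | rfl
  · exact ⟨b, c, by grind⟩
  · exact ⟨a, c, by grind⟩
  · exact ⟨a, b, by grind⟩

theorem exists_of_degree_three_of_adj_of_adj {v x y : V} (hv : H.degree v = 3) (hx : H.Adj v x)
    (hy : H.Adj v y) (hxy : x ≠ y) :
    ∃ z, z ≠ x ∧ z ≠ y ∧ ∀ u, H.Adj v u ↔ u = x ∨ u = y ∨ u = z := by
  obtain ⟨a, b, hax, hbx, hab, h⟩ := exists_of_degree_three_of_adj hv hx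
  rcases (h y).1 hy with rfl | rfl | rfl
  · exact absurd rfl hxy
  · exact ⟨b, by grind⟩
  · exact ⟨a, by grind⟩

theorem adj_iff_of_degree_three {v x y z : V} (hv : H.degree v = 3) (hx : H.Adj v x)
    (hy : H.Adj v y) (hz : H.Adj v z) (hxy : x ≠ y) (hxz : x ≠ z) (hyz : y ≠ z) (u : V) :
    H.Adj v u ↔ u = x ∨ u = y ∨ u = z := by
  obtain ⟨a, hax, hay, h⟩ := exists_of_degree_three_of_adj_of_adj hv hx hy hxy
  grind

namespace Sparse

variable (hs : Sparse H)
include hs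

theorem triangle {v : V} (hv : H.degree v = 2) (hN : ∀ u, H.Adj v u → H.degree u = 2) :
    ∃ x y, x ≠ y ∧ H.Adj x y ∧ ∀ u, H.Adj v u ↔ u = x ∨ u = y := by
  obtain ⟨x, y, hxy, h⟩ := exists_of_degree_two hv
  have hx := (h x).2 (Or.inl rfl)
  have hy := (h y).2 (Or.inr rfl)
  exact ⟨x, y, hxy, hs.adj_of_two_two v x y (hN x hx) (hN y hy) hx hy hxy, h⟩

theorem exists_iso {k : ℕ} (X : SimpleGraph (Fin k)) (e : Fin k → V)
    (he : Function.Injective e) (heX : ∀ i v, H.Adj (e i) v ↔ ∃ j, X.Adj i j ∧ v = e j)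
    (hout : ∀ v ∉ Set.range e, H.degree v = 2) :
    ∃ m, Fintype.card V = 3 * m + k ∧ Nonempty (H ≃g copies m (K 3) ⊕g X) := by
  have h := exists_iso_copies_sum e he heX fun v hv => hs.triangle (hout v hv) (by
    rintro u hu
    refine hout u ?_
    rintro ⟨i, rfl⟩
    obtain ⟨j, -, rfl⟩ := (heX i v).1 hu.symm
    exact hv ⟨j, rfl⟩)
  rw [Fintype.card_fin] at h
  exact ⟨_, by omega, h.2.2⟩

/-- The tool for excluding configurations: a closed set containing all vertices of degree other than
2 leaves only triangles outside, so if its size is divisible by 3, so is the order. -/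
theorem dvd_card (l : List V) (hl : l.Nodup) (hlen : 3 ∣ l.length)
    (hcl : ∀ v ∈ l, ∀ u, H.Adj v u → u ∈ l) (hout : ∀ v ∉ l, H.degree v = 2) :
    3 ∣ Fintype.card V := by
  have hinj := List.nodup_iff_injective_get.1 hl
  have hr : Set.range l.get = {v | v ∈ l} := Set.range_list_get l
  obtain ⟨m, hm, -⟩ := hs.exists_iso (H.comap l.get) l.get hinj (by
    intro i v
    constructor
    · intro h
      obtain ⟨j, rfl⟩ := List.mem_iff_get.1 (hcl _ (List.get_mem l i) _ h)
      exact ⟨j, h, rfl⟩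
    · rintro ⟨j, h, rfl⟩
      exact h) (fun v hv => hout v (by rw [hr] at hv; exact hv))
  omega

theorem petal {w x y : V} (hx : H.degree x = 2) (hy : H.degree y = 2) (hwx : H.Adj w x)
    (hwy : H.Adj w y) (hxy : x ≠ y) :
    (∀ u, H.Adj x u ↔ u = w ∨ u = y) ∧ ∀ u, H.Adj y u ↔ u = w ∨ u = x := by
  have h := hs.adj_of_two_two w x y hx hy hwx hwy hxy
  have hwx' := hwx.ne
  have hwy' := hwy.ne
  obtain ⟨a, ha, hxa⟩ := exists_of_degree_two_of_adj hx hwx.symm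
  obtain ⟨b, hb, hyb⟩ := exists_of_degree_two_of_adj hy hwy.symm
  have h1 := (hxa y).1 h
  have h2 := (hyb x).1 h.symm
  grind

/-- With `s` set aside, the two remaining neighbours of `w` have degree 2 and a common neighbour,
hence are adjacent: a triangle hangs at `w`. -/
theorem pendant {w s : V} (hw : H.degree w = 3) (hws : H.Adj w s)
    (hN : ∀ u, H.Adj w u → u = s ∨ H.degree u = 2) :
    ∃ x y, x ≠ y ∧ x ≠ s ∧ y ≠ s ∧ H.degree x = 2 ∧ H.degree y = 2 ∧
      H.Adj w x ∧ H.Adj w y ∧ H.Adj x y ∧ (∀ u, H.Adj w u ↔ u = s ∨ u = x ∨ u = y) ∧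
      (∀ u, H.Adj x u ↔ u = w ∨ u = y) ∧ (∀ u, H.Adj y u ↔ u = w ∨ u = x) := by
  obtain ⟨x, y, hxs, hys, hxy, h⟩ := exists_of_degree_three_of_adj hw hws
  have hx : H.degree x = 2 := (hN x ((h x).2 (by simp))).resolve_left hxs
  have hy : H.degree y = 2 := (hN y ((h y).2 (by simp))).resolve_left hys
  have hp := hs.petal hx hy ((h x).2 (by simp)) ((h y).2 (by simp)) hxy
  exact ⟨x, y, hxy, hxs, hys, hx, hy, (h x).2 (by simp), (h y).2 (by simp),
    (hp.1 y).2 (by simp), h, hp.1, hp.2⟩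

/-- Follow the unique neighbour `x` of degree 2 away from `w`. After one or two vertices of degree 2
the path reaches a vertex `z` of another degree; in the longer case `z` cannot be adjacent to `w`.
-/
theorem single {w s t : V} (hw : H.degree w = 3) (hws : H.Adj w s) (hwt : H.Adj w t)
    (hst : s ≠ t) (hs2 : H.degree s ≠ 2) (ht2 : H.degree t ≠ 2)
    (hN : ∀ u, H.Adj w u → u = s ∨ u = t ∨ H.degree u = 2) :
    ∃ x, H.degree x = 2 ∧ H.Adj w x ∧ (∀ u, H.Adj w u ↔ u = s ∨ u = t ∨ u = x) ∧
      ((∃ z, z ≠ w ∧ H.degree z ≠ 2 ∧ H.Adj x z ∧ ∀ u, H.Adj x u ↔ u = w ∨ u = z) ∨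
        ∃ y z, H.degree y = 2 ∧ y ≠ x ∧ z ≠ w ∧ H.degree z ≠ 2 ∧ ¬ H.Adj w z ∧
          H.Adj x y ∧ H.Adj y z ∧ (∀ u, H.Adj x u ↔ u = w ∨ u = y) ∧
          ∀ u, H.Adj y u ↔ u = x ∨ u = z) := by
  obtain ⟨x, hxs, hxt, h⟩ := exists_of_degree_three_of_adj_of_adj hw hws hwt hst
  have hwx : H.Adj w x := (h x).2 (by simp)
  have hx : H.degree x = 2 := by
    have := hN x hwx
    tauto
  refine ⟨x, hx, hwx, h, ?_⟩
  obtain ⟨y, hyw, hxN⟩ := exists_of_degree_two_of_adj hx hwx.symm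
  have hxy : H.Adj x y := (hxN y).2 (by simp)
  by_cases hy : H.degree y = 2
  · right
    obtain ⟨z, hzx, hyN⟩ := exists_of_degree_two_of_adj hy hxy.symm
    have hyz : H.Adj y z := (hyN z).2 (by simp)
    have hzw : z ≠ w := by
      rintro rfl
      rcases (h y).1 hyz.symm with rfl | rfl | rfl
      · exact hs2 hy
      · exact ht2 hy
      · exact hxy.ne rfl
    -- Otherwise `x` and `z`, both of degree 2 and neighbours of `y`, would be adjacent, but `x` has
    -- only the neighbours `w` and `y`.
    have hz : H.degree z ≠ 2 := by
      intro hz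
      have := hs.adj_of_two_two y x z hx hz hxy.symm hyz hzx.symm
      rcases (hxN z).1 this with h1 | h1
      · exact hzw h1
      · exact hyz.ne h1.symm
    have hyw' : ¬ H.Adj y w := by
      intro h1
      rcases (hyN w).1 h1 with h2 | h2
      · exact hwx.ne h2
      · exact hzw h2.symm
    refine ⟨y, z, hy, hxy.ne.symm, hzw, hz, ?_, hxy, hyz, hxN, hyN⟩
    intro hwz
    -- Otherwise `y` and `w`, of degrees 2 and 3 and non-adjacent, would share both `x` and `z`.
    exact hzx (hs.eq_of_two_three y w x z hy hw hyw hyw' hxy.symm hwx hyz hwz).symm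
  · exact Or.inl ⟨y, hyw, hy, hxy, hxN⟩

end Sparse

/-! ### Four vertices of degree three -/

/-- The four vertices `a`, `b`, `c`, `d` are distinct, have degree three, and all the other
vertices have degree two. -/
structure Quad (H : SimpleGraph V) [DecidableRel H.Adj] (a b c d : V) : Prop where
  nodup : a ≠ b ∧ a ≠ c ∧ a ≠ d ∧ b ≠ c ∧ b ≠ d ∧ c ≠ d
  three : H.degree a = 3 ∧ H.degree b = 3 ∧ H.degree c = 3 ∧ H.degree d = 3
  two : ∀ v, v = a ∨ v = b ∨ v = c ∨ v = d ∨ H.degree v = 2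

/-- `H` is the disjoint union of triangles and `X`. -/
def IsTrianglesAdd {U : Type*} (H : SimpleGraph V) (X : SimpleGraph U) : Prop :=
  ∃ m, Fintype.card V = 3 * m + Nat.card U ∧ Nonempty (H ≃g copies m (K 3) ⊕g X)

theorem Sparse.isTrianglesAdd (hs : Sparse H) {k : ℕ} (X : SimpleGraph (Fin k)) (e : Fin k → V)
    (he : Function.Injective e) (heX : ∀ i v, H.Adj (e i) v ↔ ∃ j, X.Adj i j ∧ v = e j)
    (hout : ∀ v, (∃ i, e i = v) ∨ H.degree v = 2) : IsTrianglesAdd H X := by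
  obtain ⟨m, h⟩ := hs.exists_iso X e he heX fun v hv => (hout v).resolve_left hv
  exact ⟨m, by simpa using h⟩

namespace Quad

variable {a b c d : V}

theorem complete (hs : Sparse H) (hq : Quad H a b c d) (hab : H.Adj a b) (hac : H.Adj a c)
    (had : H.Adj a d) (hbc : H.Adj b c) (hbd : H.Adj b d) (hcd : H.Adj c d) :
    IsTrianglesAdd H (K 4) := by
  obtain ⟨⟨nab, nac, nad, nbc, nbd, ncd⟩, ⟨ha, hb, hc, hd⟩, h2⟩ := hq
  have hNa := adj_iff_of_degree_three ha hab hac had nbc nbd ncd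
  have hNb := adj_iff_of_degree_three hb hab.symm hbc hbd nac nad ncd
  have hNc := adj_iff_of_degree_three hc hac.symm hbc.symm hcd nab nad nbd
  have hNd := adj_iff_of_degree_three hd had.symm hbd.symm hcd.symm nab nac nbc
  refine hs.isTrianglesAdd (K 4) ![a, b, c, d] ?_ ?_ ?_
  · rw [← List.nodup_ofFn]
    simp; grind
  · intro i v
    fin_cases i <;> simp [Fin.exists_fin_succ, hNa, hNb, hNc, hNd]
  · intro v
    simp [Fin.exists_fin_succ]
    grind

theorem claw (hs : Sparse H) (hq : Quad H a b c d) (hab : H.Adj a b) (hac : H.Adj a c)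
    (had : H.Adj a d) (hbc : ¬ H.Adj b c) (hbd : ¬ H.Adj b d) (hcd : ¬ H.Adj c d) :
    IsTrianglesAdd H Q := by
  obtain ⟨⟨nab, nac, nad, nbc, nbd, ncd⟩, ⟨ha, hb, hc, hd⟩, h2⟩ := hq
  have hsymm := fun x y => H.adj_comm x y
  have hirr := fun x => H.irrefl (v := x)
  have hNa := adj_iff_of_degree_three ha hab hac had nbc nbd ncd
  obtain ⟨b₁, b₂, hb12, -, -, hb1, hb2, eb1, eb2, eb12,
    hNb, hNb1, hNb2⟩ := hs.pendant hb hab.symm (by grind)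
  obtain ⟨c₁, c₂, hc12, -, -, hc1, hc2, ec1, ec2, ec12,
    hNc, hNc1, hNc2⟩ := hs.pendant hc hac.symm (by grind)
  obtain ⟨d₁, d₂, hd12, -, -, hd1, hd2, ed1, ed2, ed12,
    hNd, hNd1, hNd2⟩ := hs.pendant hd had.symm (by grind)
  refine hs.isTrianglesAdd Q ![a, b, c, d, b₁, b₂, c₁, c₂, d₁, d₂] ?_ ?_ ?_
  · rw [← List.nodup_ofFn]
    simp
    and_intros <;> grind
  · intro i v
    fin_cases i <;> simp [Fin.exists_fin_succ, hNa, hNb, hNc, hNd, hNb1, hNb2, hNc1, hNc2,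
      hNd1, hNd2, Q]
  · intro v
    simp [Fin.exists_fin_succ]
    grind

/-- The path leaving `b` through degree-2 vertices has nowhere to end: `a` is saturated, `d` carries
a pendant triangle, and ending at `c` after one step gives `x` and `a` two common neighbours. -/
theorem paw (hs : Sparse H) (hq : Quad H a b c d) (hab : H.Adj a b) (hac : H.Adj a c)
    (had : H.Adj a d) (hbc : H.Adj b c) (hbd : ¬ H.Adj b d) (hcd : ¬ H.Adj c d) : False := by
  obtain ⟨⟨nab, nac, nad, nbc, nbd, ncd⟩, ⟨ha, hb, hc, hd⟩, h2⟩ := hq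
  have hsymm := fun x y => H.adj_comm x y
  have hirr := fun x => H.irrefl (v := x)
  have hNa := adj_iff_of_degree_three ha hab hac had nbc nbd ncd
  obtain ⟨d₁, d₂, hd12, -, -, hd1, hd2, ed1, ed2, ed12, hNd, hNd1, hNd2⟩ :=
    hs.pendant hd had.symm (by grind)
  obtain ⟨x, hx, hbx, hNb, h⟩ := hs.single hb hab.symm hbc nac (by omega) (by omega) (by grind)
  rcases h with ⟨z, hzb, hz, hxz, hNx⟩ | ⟨y, z, hy, hyx, hzb, hz, hbz, hxy, hyz, hNx, hNy⟩
  · have hxa : ¬ H.Adj a x := by grind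
    obtain rfl | rfl | rfl | h := h2 z
    · grind
    · grind
    · have := hs.eq_of_two_three x a b z hx ha
      grind
    · grind
  · obtain rfl : z = d := by grind
    grind

/-- The path leaving `c` must end at `d`. With one inner vertex, `c` and `d` would have equal
neighbourhoods; with two, the component has 6 vertices. -/
theorem diamond (hs : Sparse H) (hq : Quad H a b c d) (h3 : ¬ 3 ∣ Fintype.card V)
    (hab : H.Adj a b) (hac : H.Adj a c)
    (had : H.Adj a d) (hbc : H.Adj b c) (hbd : H.Adj b d) (hcd : ¬ H.Adj c d) : False := by
  obtain ⟨⟨nab, nac, nad, nbc, nbd, ncd⟩, ⟨ha, hb, hc, hd⟩, h2⟩ := hq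
  have hsymm := fun x y => H.adj_comm x y
  have hirr := fun x => H.irrefl (v := x)
  have hNa := adj_iff_of_degree_three ha hab hac had nbc nbd ncd
  have hNb := adj_iff_of_degree_three hb hab.symm hbc hbd nac nad ncd
  obtain ⟨x, hx, hcx, hNc, h⟩ :=
    hs.single hc hac.symm hbc.symm nab (by omega) (by omega) (by grind)
  rcases h with ⟨z, hzc, hz, hxz, hNx⟩ | ⟨y, z, hy, hyx, hzc, hz, hcz, hxy, hyz, hNx, hNy⟩
  · obtain rfl : z = d := by grind
    obtain ⟨w, hcw, hdw⟩ := hs.exists_of_three_three c z hc hd ncd hcd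
    grind
  · obtain rfl : z = d := by grind
    have hNd := adj_iff_of_degree_three hd had.symm hbd.symm hyz.symm nab (by grind) (by grind)
    refine h3 (hs.dvd_card [a, b, c, z, x, y] ?_ (by simp) ?_ ?_)
    · simp; and_intros <;> grind
    · simp; and_intros <;> grind
    · simp; grind

theorem reflect (hq : Quad H a b c d) : Quad H a d c b := by
  obtain ⟨⟨nab, nac, nad, nbc, nbd, ncd⟩, ⟨ha, hb, hc, hd⟩, h2⟩ := hq
  exact ⟨⟨nad, nac, nab, ncd.symm, nbd.symm, nbc.symm⟩, ⟨ha, hd, hc, hb⟩, fun v => by grind⟩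

/-- If `a` and `b` share a degree-2 neighbour, then `c` and `d` must too, which closes a set of 6
vertices. -/
theorem square_aux (hs : Sparse H) (hq : Quad H a b c d) (h3 : ¬ 3 ∣ Fintype.card V)
    (hab : H.Adj a b) (hbc : H.Adj b c) (hcd : H.Adj c d) (hda : H.Adj d a)
    (hac : ¬ H.Adj a c) (hbd : ¬ H.Adj b d) {x : V} (hx : H.degree x = 2)
    (hNx : ∀ u, H.Adj x u ↔ u = a ∨ u = b) : False := by
  obtain ⟨⟨nab, nac, nad, nbc, nbd, ncd⟩, ⟨ha, hb, hc, hd⟩, h2⟩ := hq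
  have hsymm := fun x y => H.adj_comm x y
  have hirr := fun x => H.irrefl (v := x)
  have hxa : H.Adj x a := by grind
  have hxb : H.Adj x b := by grind
  have hNa := adj_iff_of_degree_three ha hab hda.symm hxa.symm nbd (by grind) (by grind)
  have hNb := adj_iff_of_degree_three hb hab.symm hbc hxb.symm nac (by grind) (by grind)
  obtain ⟨y, hy, hcy, hNc, h⟩ :=
    hs.single hc hbc.symm hcd nbd (by omega) (by omega) (by grind)
  rcases h with ⟨z, hzc, hz, hyz, hNy⟩ | ⟨y', z, hy', hyy, hzc, hz, hcz, hyy', hyz, hNy, hNy'⟩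
  · obtain rfl : z = d := by grind
    have hNd := adj_iff_of_degree_three hd hda hcd.symm hyz.symm nac (by grind) (by grind)
    refine h3 (hs.dvd_card [a, b, c, z, x, y] ?_ (by simp) ?_ ?_)
    · simp; and_intros <;> grind
    · simp; and_intros <;> grind
    · simp; grind
  · obtain rfl : z = a := by grind
    grind

/-- Once short paths between consecutive corners (`square_aux`) and between opposite corners (two
common neighbours) are excluded, opposite corners are joined by paths of length 3, which is `W`. -/
theorem square (hs : Sparse H) (hq : Quad H a b c d) (h3 : ¬ 3 ∣ Fintype.card V)
    (hab : H.Adj a b) (hbc : H.Adj b c) (hcd : H.Adj c d) (hda : H.Adj d a)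
    (hac : ¬ H.Adj a c) (hbd : ¬ H.Adj b d) : IsTrianglesAdd H W := by
  obtain ⟨⟨nab, nac, nad, nbc, nbd, ncd⟩, ⟨ha, hb, hc, hd⟩, h2⟩ := id hq
  have hsymm := fun x y => H.adj_comm x y
  have hirr := fun x => H.irrefl (v := x)
  obtain ⟨x, hx, hax, hNa, h⟩ := hs.single ha hab hda.symm nbd (by omega) (by omega) (by grind)
  rcases h with ⟨z, hza, hz, hxz, hNx⟩ | ⟨y, z, hy, hyx, hza, hz, haz, hxy, hyz, hNx, hNy⟩
  · exfalso
    obtain rfl | rfl | rfl | rfl | h := h2 z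
    · exact hza rfl
    · exact square_aux hs hq h3 hab hbc hcd hda hac hbd hx hNx
    · have hbx : ¬ H.Adj x b := by grind
      have := hs.eq_of_two_three x b a z hx hb
      grind
    · exact square_aux hs hq.reflect h3 hda.symm hcd.symm hbc.symm hab.symm hac
        (fun h => hbd h.symm) hx hNx
    · exact hz h
  · obtain rfl : z = c := by grind
    have hNc := adj_iff_of_degree_three hc hbc.symm hcd hyz.symm nbd (by grind) (by grind)
    obtain ⟨x', hx', hbx, hNb, h⟩ :=
      hs.single hb hab.symm hbc nac (by omega) (by omega) (by grind)
    rcases h with ⟨w, hwb, hw, hxw, hNx'⟩ | ⟨y', w, hy', hyx', hwb, hw, hbw, hxy', hyw, hNx', hNy'⟩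
    · exfalso
      obtain rfl : w = d := by grind
      have hax' : ¬ H.Adj x' a := by grind
      have := hs.eq_of_two_three x' a b w hx' ha
      grind
    · obtain rfl : w = d := by grind
      have hNd := adj_iff_of_degree_three hd hda hcd.symm hyw.symm nac (by grind) (by grind)
      refine hs.isTrianglesAdd W ![a, b, z, w, x, y, x', y'] ?_ ?_ ?_
      · rw [← List.nodup_ofFn]
        simp
        and_intros <;> grind
      · intro i v
        fin_cases i <;> simp [Fin.exists_fin_succ, hNa, hNb, hNc, hNd, hNx, hNy, hNx', hNy', W] <;>
          grind
      · intro v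
        simp [Fin.exists_fin_succ]
        grind

/-- The ends carry pendant triangles, so the third neighbour of `b` must also be that of `c`: 9
vertices in a closed set. -/
theorem path (hs : Sparse H) (hq : Quad H a b c d) (h3 : ¬ 3 ∣ Fintype.card V)
    (hab : H.Adj a b) (hbc : H.Adj b c) (hcd : H.Adj c d) (hda : ¬ H.Adj d a)
    (hac : ¬ H.Adj a c) (hbd : ¬ H.Adj b d) : False := by
  obtain ⟨⟨nab, nac, nad, nbc, nbd, ncd⟩, ⟨ha, hb, hc, hd⟩, h2⟩ := hq
  have hsymm := fun x y => H.adj_comm x y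
  have hirr := fun x => H.irrefl (v := x)
  obtain ⟨a₁, a₂, ha12, -, -, ha1, ha2, ea1, ea2, ea12,
    hNa, hNa1, hNa2⟩ := hs.pendant ha hab (by grind)
  obtain ⟨d₁, d₂, hd12, -, -, hd1, hd2, ed1, ed2, ed12,
    hNd, hNd1, hNd2⟩ := hs.pendant hd hcd.symm (by grind)
  obtain ⟨x, hx, hbx, hNb, h⟩ := hs.single hb hab.symm hbc nac (by omega) (by omega) (by grind)
  rcases h with ⟨z, hzb, hz, hxz, hNx⟩ | ⟨y, z, hy, hyx, hzb, hz, hbz, hxy, hyz, hNx, hNy⟩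
  · obtain rfl : z = c := by grind
    have hNc := adj_iff_of_degree_three hc hbc.symm hcd (z := x) (by grind) (by grind) (by grind)
      (by grind)
    refine h3 (hs.dvd_card [a, b, z, d, a₁, a₂, d₁, d₂, x] ?_ (by simp) ?_ ?_)
    · simp; and_intros <;> grind
    · simp; and_intros <;> grind
    · simp; grind
  · grind

/-- Each of the four vertices carries a pendant triangle: 12 vertices in a closed set. -/
theorem two_edges (hs : Sparse H) (hq : Quad H a b c d) (h3 : ¬ 3 ∣ Fintype.card V)
    (hab : H.Adj a b) (hcd : H.Adj c d) (hac : ¬ H.Adj a c) (had : ¬ H.Adj a d)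
    (hbc : ¬ H.Adj b c) (hbd : ¬ H.Adj b d) : False := by
  obtain ⟨⟨nab, nac, nad, nbc, nbd, ncd⟩, ⟨ha, hb, hc, hd⟩, h2⟩ := hq
  have hsymm := fun x y => H.adj_comm x y
  have hirr := fun x => H.irrefl (v := x)
  obtain ⟨a₁, a₂, ha12, -, -, ha1, ha2, ea1, ea2, ea12, hNa, hNa1, hNa2⟩ :=
    hs.pendant ha hab (by grind)
  obtain ⟨b₁, b₂, hb12, -, -, hb1, hb2, eb1, eb2, eb12, hNb, hNb1, hNb2⟩ :=
    hs.pendant hb hab.symm (by grind)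
  obtain ⟨c₁, c₂, hc12, -, -, hc1, hc2, ec1, ec2, ec12, hNc, hNc1, hNc2⟩ :=
    hs.pendant hc hcd (by grind)
  obtain ⟨d₁, d₂, hd12, -, -, hd1, hd2, ed1, ed2, ed12, hNd, hNd1, hNd2⟩ :=
    hs.pendant hd hcd.symm (by grind)
  refine h3 (hs.dvd_card [a, b, c, d, a₁, a₂, b₁, b₂, c₁, c₂, d₁, d₂] ?_ (by simp) ?_ ?_)
  · simp; and_intros <;> grind
  · simp; and_intros <;> grind
  · simp; grind

end Quad

/-- `H` consists of triangles and of one copy of `K 4`, of `Q` or of `W`. -/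
def IsExceptional (H : SimpleGraph V) : Prop :=
  IsTrianglesAdd H (K 4) ∨ IsTrianglesAdd H Q ∨ IsTrianglesAdd H W

namespace Quad

variable {a b c d : V}

theorem swap12 (hq : Quad H a b c d) : Quad H b a c d := by
  obtain ⟨⟨nab, nac, nad, nbc, nbd, ncd⟩, ⟨ha, hb, hc, hd⟩, h2⟩ := hq
  exact ⟨⟨nab.symm, nbc, nbd, nac, nad, ncd⟩, ⟨hb, ha, hc, hd⟩, fun v => by grind⟩

theorem swap23 (hq : Quad H a b c d) : Quad H a c b d := by
  obtain ⟨⟨nab, nac, nad, nbc, nbd, ncd⟩, ⟨ha, hb, hc, hd⟩, h2⟩ := hq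
  exact ⟨⟨nac, nab, nad, nbc.symm, ncd, nbd⟩, ⟨ha, hc, hb, hd⟩, fun v => by grind⟩

theorem swap34 (hq : Quad H a b c d) : Quad H a b d c := by
  obtain ⟨⟨nab, nac, nad, nbc, nbd, ncd⟩, ⟨ha, hb, hc, hd⟩, h2⟩ := hq
  exact ⟨⟨nab, nad, nac, nbd, nbc, ncd.symm⟩, ⟨ha, hb, hd, hc⟩, fun v => by grind⟩

theorem of_star (hs : Sparse H) (hq : Quad H a b c d) (h3 : ¬ 3 ∣ Fintype.card V)
    (hab : H.Adj a b) (hac : H.Adj a c) (had : H.Adj a d) : IsExceptional H := by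
  by_cases hbc : H.Adj b c <;> by_cases hbd : H.Adj b d <;> by_cases hcd : H.Adj c d
  · exact Or.inl (hq.complete hs hab hac had hbc hbd hcd)
  · exact (hq.diamond hs h3 hab hac had hbc hbd hcd).elim
  · exact (hq.swap23.diamond hs h3 hac hab had hbc.symm hcd hbd).elim
  · exact (hq.paw hs hab hac had hbc hbd hcd).elim
  · exact (hq.swap34.swap23.diamond hs h3 had hab hac hbd.symm hcd.symm hbc).elim
  · exact (hq.swap34.paw hs hab had hac hbd hbc fun h => hcd h.symm).elim
  · exact (hq.swap23.swap34.paw hs hac had hab hcd (fun h => hbc h.symm)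
      fun h => hbd h.symm).elim
  · exact Or.inr (Or.inl (hq.claw hs hab hac had hbc hbd hcd))

/-- With no vertex adjacent to the other three and none isolated among the four, only the 4-cycle,
the path and two disjoint edges remain. -/
theorem of_edge (hs : Sparse H) (hq : Quad H a b c d) (h3 : ¬ 3 ∣ Fintype.card V)
    (hN : ∀ v, H.degree v = 3 → ∃ u, H.degree u = 3 ∧ H.Adj v u)
    (hstar : ∀ w x y z, Quad H w x y z → ¬ (H.Adj w x ∧ H.Adj w y ∧ H.Adj w z))
    (hab : H.Adj a b) : IsExceptional H := by
  have sa := hstar _ _ _ _ hq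
  have sb := hstar _ _ _ _ hq.swap12
  have sc := hstar _ _ _ _ hq.swap23.swap12
  have sd := hstar _ _ _ _ hq.swap34.swap23.swap12
  have hsymm := fun x y => H.adj_comm x y
  have hirr := fun x => H.irrefl (v := x)
  have hc : H.Adj c a ∨ H.Adj c b ∨ H.Adj c d := by
    obtain ⟨u, hu, h⟩ := hN c hq.three.2.2.1
    have := hq.two u
    grind
  have hd : H.Adj d a ∨ H.Adj d b ∨ H.Adj d c := by
    obtain ⟨u, hu, h⟩ := hN d hq.three.2.2.2
    have := hq.two u
    grind
  by_cases hcd : H.Adj c d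
  · by_cases hac : H.Adj a c
    · by_cases hbd : H.Adj b d
      · exact Or.inr (Or.inr (hq.swap34.square hs h3 hab hbd hcd.symm hac.symm (by grind)
          (by grind)))
      · exact (hq.swap12.path hs h3 hab.symm hac hcd (by grind) (by grind) (by grind)).elim
    · by_cases had : H.Adj a d
      · by_cases hbc : H.Adj b c
        · exact Or.inr (Or.inr (hq.square hs h3 hab hbc hcd had.symm (by grind) (by grind)))
        · exact (hq.swap12.swap34.path hs h3 hab.symm had hcd.symm (by grind) (by grind)
            (by grind)).elim
      · by_cases hbc : H.Adj b c
        · exact (hq.path hs h3 hab hbc hcd (by grind) (by grind) (by grind)).elim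
        · by_cases hbd : H.Adj b d
          · exact (hq.swap34.path hs h3 hab hbd hcd.symm (by grind) (by grind) (by grind)).elim
          · exact (hq.two_edges hs h3 hab hcd hac had hbc hbd).elim
  · by_cases hac : H.Adj a c
    · exact (hq.swap23.swap12.path hs h3 hac.symm hab (by grind) (by grind) (by grind)
        (by grind)).elim
    · exact (hq.swap12.swap23.swap12.path hs h3 (by grind) hab.symm (by grind) (by grind)
        (by grind) (by grind)).elim

theorem isExceptional (hs : Sparse H) (hq : Quad H a b c d) (h3 : ¬ 3 ∣ Fintype.card V)
    (hN : ∀ v, H.degree v = 3 → ∃ u, H.degree u = 3 ∧ H.Adj v u) : IsExceptional H := by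
  by_cases hstar : ∃ w x y z, Quad H w x y z ∧ H.Adj w x ∧ H.Adj w y ∧ H.Adj w z
  · obtain ⟨w, x, y, z, hq', hx, hy, hz⟩ := hstar
    exact hq'.of_star hs h3 hx hy hz
  have hstar' : ∀ w x y z, Quad H w x y z → ¬ (H.Adj w x ∧ H.Adj w y ∧ H.Adj w z) :=
    fun w x y z h h' => hstar ⟨w, x, y, z, h, h'⟩
  obtain ⟨u, hu, hau⟩ := hN a hq.three.1
  rcases hq.two u with rfl | rfl | rfl | rfl | h
  · exact (H.irrefl hau).elim
  · exact hq.of_edge hs h3 hN hstar' hau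
  · exact hq.swap23.of_edge hs h3 hN hstar' hau
  · exact hq.swap34.swap23.of_edge hs h3 hN hstar' hau
  · omega

end Quad

/-! ### Counting the vertices of degree other than two -/

namespace Sparse

/-- Three neighbours of degree 2 would be pairwise adjacent, giving each of them degree at least 3
together with `w`. -/
theorem card_filter_le (hs : Sparse H) (w : V) :
    ((H.neighborFinset w).filter fun u => H.degree u = 2).card ≤ 2 := by
  by_contra hlt
  obtain ⟨x, y, z, hx, hy, hz, hxy, hxz, hyz⟩ := Finset.two_lt_card_iff.1 (not_le.1 hlt)
  simp only [Finset.mem_filter, mem_neighborFinset] at hx hy hz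
  have h1 := (hs.petal hx.2 hy.2 hx.1 hy.1 hxy).1 z
  have h2 := hs.adj_of_two_two w x z hx.2 hz.2 hx.1 hz.1 hxz
  rcases h1.1 h2 with rfl | rfl
  · exact H.irrefl hz.1
  · exact hyz rfl

theorem degree_le (hs : Sparse H) (w : V) :
    H.degree w ≤ 2 + ((H.neighborFinset w).filter fun u => H.degree u ≠ 2).card := by
  have := hs.card_filter_le w
  have h := Finset.card_filter_add_card_filter_not (s := H.neighborFinset w)
    fun u => H.degree u = 2
  rw [card_neighborFinset_eq_degree] at h
  simp only [ne_eq]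
  omega

theorem exists_adj (hs : Sparse H) {w : V} (hw : H.degree w = 3) :
    ∃ u, H.degree u ≠ 2 ∧ H.Adj w u := by
  have := hs.degree_le w
  have hpos : 0 < ((H.neighborFinset w).filter fun u => H.degree u ≠ 2).card := by omega
  obtain ⟨u, hu⟩ := Finset.card_pos.1 hpos
  simp only [Finset.mem_filter, mem_neighborFinset] at hu
  exact ⟨u, hu.2, hu.1⟩

/-- The two vertices are adjacent and each carries a pendant triangle: 6 vertices. -/
theorem dvd_card_of_pair (hs : Sparse H) {a b : V} (hab : a ≠ b) (ha : H.degree a = 3)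
    (hb : H.degree b = 3) (h2 : ∀ v, v = a ∨ v = b ∨ H.degree v = 2) :
    3 ∣ Fintype.card V := by
  have hsymm := fun x y => H.adj_comm x y
  have hirr := fun x => H.irrefl (v := x)
  obtain ⟨u, hu, hau⟩ := hs.exists_adj ha
  have hadj : H.Adj a b := by grind
  obtain ⟨a₁, a₂, ha12, -, -, ha1, ha2, ea1, ea2, ea12, hNa, hNa1, hNa2⟩ :=
    hs.pendant ha hadj (by grind)
  obtain ⟨b₁, b₂, hb12, -, -, hb1, hb2, eb1, eb2, eb12, hNb, hNb1, hNb2⟩ :=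
    hs.pendant hb hadj.symm (by grind)
  refine hs.dvd_card [a, b, a₁, a₂, b₁, b₂] ?_ (by simp) ?_ ?_
  · simp; and_intros <;> grind
  · simp; and_intros <;> grind
  · simp; grind

/-- The vertex `a` is adjacent to `b` and `c` and lies in a triangle with its two neighbours of
degree 2. The closed set has 6 vertices if `b` and `c` are adjacent, and 9 otherwise. -/
theorem dvd_card_of_triple (hs : Sparse H) {a b c : V} (hab : a ≠ b) (hac : a ≠ c)
    (hbc : b ≠ c) (ha : H.degree a = 4) (hb : H.degree b = 3) (hc : H.degree c = 3)
    (h2 : ∀ v, v = a ∨ v = b ∨ v = c ∨ H.degree v = 2) : 3 ∣ Fintype.card V := by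
  classical
  have hsymm := fun x y => H.adj_comm x y
  have hirr := fun x => H.irrefl (v := x)
  have hsub : ((H.neighborFinset a).filter fun u => H.degree u ≠ 2) ⊆ {b, c} := by
    intro u hu
    simp only [Finset.mem_filter, mem_neighborFinset, Finset.mem_insert,
      Finset.mem_singleton] at hu ⊢
    grind
  have hle := hs.degree_le a
  have heq := Finset.eq_of_subset_of_card_le hsub (by rw [Finset.card_pair hbc]; omega)
  have eab : H.Adj a b := by
    have : b ∈ (H.neighborFinset a).filter fun u => H.degree u ≠ 2 := by rw [heq]; simp
    simp at this; exact this.1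
  have eac : H.Adj a c := by
    have : c ∈ (H.neighborFinset a).filter fun u => H.degree u ≠ 2 := by rw [heq]; simp
    simp at this; exact this.1
  obtain ⟨a₁, a₂, ha12, hNa⟩ : ∃ x y, x ≠ y ∧ x ≠ b ∧ x ≠ c ∧ y ≠ b ∧ y ≠ c ∧
      ∀ u, H.Adj a u ↔ u = b ∨ u = c ∨ u = x ∨ u = y := by
    have hcard : (H.neighborFinset a \ {b, c}).card = 2 := by
      rw [Finset.card_sdiff_of_subset (by
        intro u; simp; rintro (rfl | rfl) <;> assumption), card_neighborFinset_eq_degree,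
        Finset.card_pair hbc, ha]
    obtain ⟨x, y, hxy, h⟩ := Finset.card_eq_two.1 hcard
    have h' : ∀ u, (H.Adj a u ∧ u ≠ b ∧ u ≠ c) ↔ u = x ∨ u = y := by
      intro u
      have := Finset.ext_iff.1 h u
      simpa using this
    have hx := (h' x).2 (by simp)
    have hy := (h' y).2 (by simp)
    refine ⟨x, y, hxy, hx.2.1, hx.2.2, hy.2.1, hy.2.2, fun u => ?_⟩
    have := h' u
    grind
  obtain ⟨h1b, h1c, h2b, h2c, hNa⟩ := hNa
  have ea1 : H.Adj a a₁ := (hNa _).2 (by simp)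
  have ea2 : H.Adj a a₂ := (hNa _).2 (by simp)
  have ha1 : H.degree a₁ = 2 := by grind
  have ha2 : H.degree a₂ = 2 := by grind
  obtain ⟨hNa1, hNa2⟩ := hs.petal ha1 ha2 ea1 ea2 ha12
  have ea12 : H.Adj a₁ a₂ := (hNa1 _).2 (by simp)
  by_cases ebc : H.Adj b c
  · obtain ⟨x, hx, hbx, hNb, h⟩ :=
      hs.single hb eab.symm ebc hac (by omega) (by omega) (by grind)
    rcases h with ⟨z, hzb, hz, hxz, hNx⟩ | ⟨y, z, hy, hyx, hzb, hz, hbz, hxy, hyz, hNx, hNy⟩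
    · obtain rfl : z = c := by grind
      have hNc := adj_iff_of_degree_three hc eac.symm ebc.symm hxz.symm hab (by grind) (by grind)
      refine hs.dvd_card [a, b, z, a₁, a₂, x] ?_ (by simp) ?_ ?_
      · simp; and_intros <;> grind
      · simp; and_intros <;> grind
      · simp; grind
    · grind
  · obtain ⟨b₁, b₂, hb12, -, -, hb1, hb2, eb1, eb2, eb12, hNb, hNb1, hNb2⟩ :=
      hs.pendant hb eab.symm (by grind)
    obtain ⟨c₁, c₂, hc12, -, -, hc1, hc2, ec1, ec2, ec12, hNc, hNc1, hNc2⟩ :=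
      hs.pendant hc eac.symm (by grind)
    refine hs.dvd_card [a, b, c, a₁, a₂, b₁, b₂, c₁, c₂] ?_ (by simp) ?_ ?_
    · simp; and_intros <;> grind
    · simp; and_intros <;> grind
    · simp; grind

theorem isExceptional (hs : Sparse H) (h3 : ¬ 3 ∣ Fintype.card V)
    (hsum : ∑ v, H.degree v ≤ 2 * Fintype.card V + 4) : IsExceptional H := by
  classical
  set S := Finset.univ.filter fun v => H.degree v ≠ 2 with hS
  have hmem : ∀ v, v ∈ S ↔ H.degree v ≠ 2 := by simp [hS]
  have hfS : ∑ v ∈ S, (H.degree v - 2) + 2 * Fintype.card V = ∑ v, H.degree v := by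
    rw [Finset.sum_subset (Finset.subset_univ S) (fun v _ hv => by
      rw [hmem, not_not] at hv; omega), mul_comm, ← smul_eq_mul, ← Finset.card_univ,
      ← Finset.sum_const, ← Finset.sum_add_distrib]
    refine Finset.sum_congr rfl fun v _ => ?_
    have := hs.two_le v
    omega
  have hge : ∀ v ∈ S, 1 ≤ H.degree v - 2 := by
    intro v hv
    rw [hmem] at hv
    have := hs.two_le v
    omega
  have hcard : S.card ≤ ∑ v ∈ S, (H.degree v - 2) := by
    rw [Finset.card_eq_sum_ones]
    exact Finset.sum_le_sum hge
  -- At most two neighbours have degree 2, and at most `|S| - 1` others are available.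
  have hle : ∀ v ∈ S, H.degree v ≤ S.card + 1 := by
    intro v hv
    have hsub : ((H.neighborFinset v).filter fun u => H.degree u ≠ 2) ⊆ S.erase v := by
      intro u hu
      simp only [Finset.mem_filter, mem_neighborFinset, Finset.mem_erase, hmem] at hu ⊢
      exact ⟨hu.1.ne.symm, hu.2⟩
    have := Finset.card_le_card hsub
    have := hs.degree_le v
    rw [Finset.card_erase_of_mem hv] at *
    have : 0 < S.card := Finset.card_pos.2 ⟨v, hv⟩
    omega
  -- The total excess over degree 2 is therefore even; for `|S| = 3` it must be 4, which gives the
  -- degrees 4, 3, 3.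
  have hpar := H.sum_degrees_eq_twice_card_edges
  have hS4 : S.card ≤ 4 := by omega
  have hcases : S.card = 0 ∨ S.card = 1 ∨ S.card = 2 ∨ S.card = 3 ∨ S.card = 4 := by omega
  rcases hcases with h | h | h | h | h
  · rw [Finset.card_eq_zero] at h
    refine (h3 (hs.dvd_card [] (by simp) (by simp) (by simp) fun v _ => ?_)).elim
    by_contra hv
    have := (hmem v).2 hv
    simp [h] at this
  · obtain ⟨a, ha⟩ := Finset.card_eq_one.1 h
    have haS : a ∈ S := by simp [ha]
    have := hle a haS
    have := hge a haS
    omega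
  · obtain ⟨a, b, hab, hSab⟩ := Finset.card_eq_two.1 h
    have haS : a ∈ S := by simp [hSab]
    have hbS : b ∈ S := by simp [hSab]
    have ha := hle a haS
    have ha' := hge a haS
    have hb := hle b hbS
    have hb' := hge b hbS
    refine (h3 (hs.dvd_card_of_pair hab (by omega) (by omega) fun v => ?_)).elim
    have := hmem v
    simp only [hSab, Finset.mem_insert, Finset.mem_singleton] at this
    tauto
  · obtain ⟨a, b, c, hab, hac, hbc, hSabc⟩ := Finset.card_eq_three.1 h
    have haS : a ∈ S := by simp [hSabc]
    have hbS : b ∈ S := by simp [hSabc]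
    have hcS : c ∈ S := by simp [hSabc]
    have ha := hle a haS
    have ha' := hge a haS
    have hb := hle b hbS
    have hb' := hge b hbS
    have hc := hle c hcS
    have hc' := hge c hcS
    have hsum3 : ∑ v ∈ S, (H.degree v - 2) =
        (H.degree a - 2) + (H.degree b - 2) + (H.degree c - 2) := by
      rw [hSabc, Finset.sum_insert (by simp [hab, hac]), Finset.sum_pair hbc, add_assoc]
    have h2 : ∀ v, v = a ∨ v = b ∨ v = c ∨ H.degree v = 2 := by
      intro v
      have := hmem v
      simp only [hSabc, Finset.mem_insert, Finset.mem_singleton] at this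
      tauto
    have hdeg : (H.degree a = 4 ∧ H.degree b = 3 ∧ H.degree c = 3) ∨
        (H.degree a = 3 ∧ H.degree b = 4 ∧ H.degree c = 3) ∨
        (H.degree a = 3 ∧ H.degree b = 3 ∧ H.degree c = 4) := by omega
    refine (h3 ?_).elim
    rcases hdeg with ⟨da, db, dc⟩ | ⟨da, db, dc⟩ | ⟨da, db, dc⟩
    · exact hs.dvd_card_of_triple hab hac hbc da db dc h2
    · exact hs.dvd_card_of_triple hab.symm hbc hac db da dc fun v => by have := h2 v; tauto
    · exact hs.dvd_card_of_triple hac.symm hbc.symm hab dc da db fun v => by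
        have := h2 v; tauto
  · obtain ⟨a, T, haT, hST, hT⟩ := Finset.card_eq_succ.1 h
    obtain ⟨b, c, d, hbc, hbd, hcd, rfl⟩ := Finset.card_eq_three.1 hT
    simp only [Finset.mem_insert, Finset.mem_singleton, not_or] at haT
    obtain ⟨hab, hac, had⟩ := haT
    have haS : a ∈ S := by simp [← hST]
    have hbS : b ∈ S := by simp [← hST]
    have hcS : c ∈ S := by simp [← hST]
    have hdS : d ∈ S := by simp [← hST]
    have hsum4 : ∑ v ∈ S, (H.degree v - 2) =
        (H.degree a - 2) + (H.degree b - 2) + (H.degree c - 2) + (H.degree d - 2) := by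
      rw [← hST, Finset.sum_insert (by simp [hab, hac, had]),
        Finset.sum_insert (by simp [hbc, hbd]), Finset.sum_pair hcd]
      ring
    have ha' := hge a haS
    have hb' := hge b hbS
    have hc' := hge c hcS
    have hd' := hge d hdS
    have h2 : ∀ v, v = a ∨ v = b ∨ v = c ∨ v = d ∨ H.degree v = 2 := by
      intro v
      have := hmem v
      simp only [← hST, Finset.mem_insert, Finset.mem_singleton] at this
      tauto
    have hq : Quad H a b c d := ⟨⟨hab, hac, had, hbc, hbd, hcd⟩,
      ⟨by omega, by omega, by omega, by omega⟩, h2⟩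
    refine hq.isExceptional hs h3 fun v hv => ?_
    obtain ⟨u, hu, hvu⟩ := hs.exists_adj hv
    refine ⟨u, ?_, hvu⟩
    obtain ⟨h1, h2, h3, h4⟩ := hq.three
    rcases hq.two u with rfl | rfl | rfl | rfl | h <;> tauto

end Sparse

/-! ### Minimality and the main theorem -/

theorem IsTrianglesAdd.good_and_sum {k : ℕ} {X : SimpleGraph (Fin k)} [DecidableRel X.Adj]
    (h : IsTrianglesAdd H X) (hX : Good X) (hX2 : ∀ v, 2 ≤ X.degree v)
    (hsum : ∑ v, X.degree v = 2 * k + 4) :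
    Good H ∧ ∑ v, H.degree v = 2 * Fintype.card V + 4 := by
  classical
  obtain ⟨m, hm, ⟨e⟩⟩ := h
  rw [Nat.card_eq_fintype_card, Fintype.card_fin] at hm
  refine ⟨((good_copies m).sum hX (fun v => (degree_copies m v).ge) hX2).iso e.symm, ?_⟩
  rw [sum_degree_iso e, sum_degree_sum_copies, hsum]
  omega

theorem IsExceptional.good_and_sum (h : IsExceptional H) :
    Good H ∧ ∑ v, H.degree v = 2 * Fintype.card V + 4 := by
  rcases h with h | h | h
  · exact h.good_and_sum good_K (by decide) (by decide)
  · exact h.good_and_sum good_Q (by decide) (by decide)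
  · exact h.good_and_sum good_W (by decide) (by decide)

theorem isTrianglesAdd_iff {H : SimpleGraph V} {k m : ℕ} (X : SimpleGraph (Fin k))
    (hV : Fintype.card V = 3 * m + k) :
    IsTrianglesAdd H X ↔ Nonempty (H ≃g copies m (K 3) ⊕g X) := by
  constructor
  · rintro ⟨m', hm', h⟩
    rw [Nat.card_eq_fintype_card, Fintype.card_fin] at hm'
    obtain rfl : m = m' := by omega
    exact h
  · exact fun h => ⟨m, by simpa using hV, h⟩

theorem exists_isTrianglesAdd {k m : ℕ} (X : SimpleGraph (Fin k))
    (hV : Fintype.card V = 3 * m + k) : ∃ H : SimpleGraph V, IsTrianglesAdd H X := by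
  have hc : Fintype.card ((Fin m × Fin 3) ⊕ Fin k) = Fintype.card V := by
    simp [hV, mul_comm]
  let e := Fintype.equivOfCardEq hc
  exact ⟨_, (isTrianglesAdd_iff X hV).2 ⟨(Iso.map e (copies m (K 3) ⊕g X)).symm⟩⟩

theorem extremal_iff_isExceptional {p : ℕ} (hp : 4 ≤ p) (hV : Fintype.card V = p + 5)
    (h3 : ¬ 3 ∣ Fintype.card V) (hex : ∃ H : SimpleGraph V, IsExceptional H)
    (G : SimpleGraph V) [DecidableRel G.Adj] :
    ((book p).Free G ∧ G.edgeFinset.card = extremalNumber (p + 5) (book p)) ↔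
      IsExceptional Gᶜ := by
  classical
  have key : ∀ (H : SimpleGraph V) [DecidableRel H.Adj], Good H →
      ∑ v, H.degree v ≤ 2 * Fintype.card V + 4 → IsExceptional H := fun H _ hH hsum =>
    (hH.sparse (hH.two_le_degree (by omega) hsum)).isExceptional h3 hsum
  rw [extremal_iff p hV]
  constructor
  · rintro ⟨hG, hmin⟩
    obtain ⟨H, hH⟩ := hex
    obtain ⟨hgood, hsum⟩ := hH.good_and_sum
    exact key _ hG ((hmin H hgood).trans hsum.le)
  · intro h
    obtain ⟨hgood, hsum⟩ := h.good_and_sum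
    refine ⟨hgood, fun H _ hH => ?_⟩
    -- A good graph with smaller degree sum would itself be exceptional, hence have degree sum
    -- exactly `2n + 4`.
    by_contra hlt
    have := (key H hH (by omega)).good_and_sum.2
    omega

theorem extremal_iff_triangles {p : ℕ} (hp : 4 ≤ p) (hV : Fintype.card V = p + 5)
    (h3 : 3 ∣ Fintype.card V) (G : SimpleGraph V) [DecidableRel G.Adj] :
    ((book p).Free G ∧ G.edgeFinset.card = extremalNumber (p + 5) (book p)) ↔
      Nonempty (Gᶜ ≃g copies (Fintype.card V / 3) (K 3)) := by
  classical
  have hcop : ∀ (H : SimpleGraph V) [DecidableRel H.Adj],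
      Nonempty (H ≃g copies (Fintype.card V / 3) (K 3)) →
        Good H ∧ ∑ v, H.degree v = 2 * Fintype.card V := by
    rintro H _ ⟨e⟩
    refine ⟨(good_copies _).iso e.symm, ?_⟩
    rw [sum_degree_iso e]
    simp only [degree_copies, Finset.sum_const, Finset.card_univ, Fintype.card_prod,
      Fintype.card_fin, smul_eq_mul]
    omega
  rw [extremal_iff p hV]
  constructor
  · rintro ⟨hG, hmin⟩
    have hc : Fintype.card (Fin (Fintype.card V / 3) × Fin 3) = Fintype.card V := by
      rw [Fintype.card_prod, Fintype.card_fin, Fintype.card_fin]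
      omega
    let e := Fintype.equivOfCardEq hc
    obtain ⟨hgood, hsum⟩ := hcop _ ⟨(Iso.map e (copies (Fintype.card V / 3) (K 3))).symm⟩
    have hle := (hmin _ hgood).trans hsum.le
    have h2 := hG.two_le_degree (by omega) (by omega)
    -- Minimum degree 2 and degree sum at most `2n` force 2-regularity.
    have heq : ∀ v, Gᶜ.degree v = 2 := by
      have hc : ∑ v : V, 2 = 2 * Fintype.card V := by simp [mul_comm]
      have := (Finset.sum_eq_sum_iff_of_le (s := Finset.univ) fun v _ => h2 v).1
        (le_antisymm (Finset.sum_le_sum fun v _ => h2 v) (by omega))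
      exact fun v => (this v (Finset.mem_univ v)).symm
    exact (exists_iso_copies_of_triangles fun v =>
      (hG.sparse h2).triangle (heq v) fun u _ => heq u).2
  · intro h
    obtain ⟨hgood, hsum⟩ := hcop _ h
    refine ⟨hgood, fun H _ hH => ?_⟩
    by_contra hlt
    have h2 := hH.two_le_degree (by omega) (by omega)
    have hc : ∑ v : V, 2 = 2 * Fintype.card V := by simp [mul_comm]
    have := Finset.sum_le_sum fun v (_ : v ∈ Finset.univ) => h2 v
    omega

theorem not_isTrianglesAdd {H : SimpleGraph V} {k : ℕ} {X : SimpleGraph (Fin k)}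
    (h : Fintype.card V % 3 ≠ k % 3) : ¬ IsTrianglesAdd H X := by
  rintro ⟨m, hm, -⟩
  rw [Nat.card_eq_fintype_card, Fintype.card_fin] at hm
  omega

end BookTuran

open BookTuran SimpleGraph in
theorem theorem12 (p : ℕ) (hp : 4 ≤ p) {V : Type*} [Fintype V] (G : SimpleGraph V)
    [DecidableRel G.Adj] (hcard : Fintype.card V = p + 5) :
    (p ≡ 0 [MOD 3] →
      ((book p).Free G ∧ G.edgeFinset.card = extremalNumber (p + 5) (book p) ↔
        Nonempty (G ≃g (copies ((p - 3) / 3) (K 3) ⊕g W)ᶜ))) ∧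
    (p ≡ 1 [MOD 3] →
      ((book p).Free G ∧ G.edgeFinset.card = extremalNumber (p + 5) (book p) ↔
        Nonempty (G ≃g (copies ((p + 5) / 3) (K 3))ᶜ))) ∧
    (p ≡ 2 [MOD 3] →
      ((book p).Free G ∧ G.edgeFinset.card = extremalNumber (p + 5) (book p) ↔
        (Nonempty (G ≃g (copies ((p + 1) / 3) (K 3) ⊕g K 4)ᶜ) ∨
          Nonempty (G ≃g (copies ((p - 5) / 3) (K 3) ⊕g Q)ᶜ)))) := by
  classical
  refine ⟨fun h => ?_, fun h => ?_, fun h => ?_⟩ <;> rw [Nat.ModEq] at h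
  · have hW : Fintype.card V = 3 * ((p - 3) / 3) + 8 := by omega
    rw [extremal_iff_isExceptional hp hcard (by omega)
      ((exists_isTrianglesAdd W hW).imp fun _ h => Or.inr (Or.inr h)), iso_compl_iff,
      ← isTrianglesAdd_iff W hW, IsExceptional,
      -- Here `n` is 2 modulo 3, which excludes the components `K 4` and `Q`, of orders 4 and 10.
      or_iff_right (not_isTrianglesAdd (by omega)), or_iff_right (not_isTrianglesAdd (by omega))]
  · rw [extremal_iff_triangles hp hcard (by omega), iso_compl_iff, hcard]
  · have hK : Fintype.card V = 3 * ((p + 1) / 3) + 4 := by omega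
    have hQ : Fintype.card V = 3 * ((p - 5) / 3) + 10 := by omega
    rw [extremal_iff_isExceptional hp hcard (by omega)
      ((exists_isTrianglesAdd (K 4) hK).imp fun _ h => Or.inl h), iso_compl_iff, iso_compl_iff,
      ← isTrianglesAdd_iff (K 4) hK, ← isTrianglesAdd_iff Q hQ, IsExceptional,
      or_iff_left (not_isTrianglesAdd (X := W) (by omega))]
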